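/- For a finite group $G$, a sequence $a_1,\dots,a_n$ of elements of $G$ is called an Ordered Generating System (OGS) of $G$ with bounds $m_1,\dots,m_n\in\mathbb{Z}_{\ge 0}$ if every $g\in G$ has a unique representation $g=a_1^{i_1}a_2^{i_2}\cdots a_n^{i_n}$ with integers $0\le i_k\le m_k$ for $1\le k\le n$; it is called an OGS if it is one for some bounds. Let $M_{24}\le S_{24}$ be generated by $D=(1,2,3,\dots,23)$, $E=(3,17,10,7,9)(4,13,14,19,5)(8,18,11,12,23)(15,20,22,21,16)$ and $F=(1,24)(2,23)(3,12)(4,16)(5,18)(6,10)(7,20)(8,14)(9,21)(11,17)(13,22)(15,19)$, let $M_{23}$ be the stabilizer of the point $24$ in $M_{24}$, and let $M_{22}\le S_{22}$ be generated by $X=(1,2,\dots,11)(12,13,\dots,22)$, $Y=(1,4,5,9,3)(2,8,10,7,6)(12,15,16,20,14)(13,19,21,18,17)$ and $V=(11,22)(1,21)(2,10,8,6)(12,14,16,20)(3,13,4,17)(5,19,9,18)$. Theorem 6. The Mathieu group $M_{23}$ has an Ordered Generating System. More precisely: $M_{23}$ has a subgroup of index $23$ that is isomorphic to $M_{22}$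 and has an OGS; $M_{23}$ has an element of order $23$; and $23$ is coprime to $|M_{22}|$. Moreover, whenever $H\le M_{23}$ is a subgroup of index $23$ isomorphic to $M_{22}$ and $x\in M_{23}$ has order $23$, every element of $M_{23}$ lies in $x^iH$ for exactly one $i$ with $0\le i<23$, and for every OGS $a_1,\dots,a_n$ of $H$ with bounds $m_1,\dots,m_n$, the sequence $x,a_1,\dots,a_n$ is an OGS of $M_{23}$ with bounds $22,m_1,\dots,m_n$. -/

import Mathlib

open Equiv

/-- Every `g : G` is `a₁ ^ i₁ * a₂ ^ i₂ * ⋯ * aₙ ^ iₙ` (factors in this order) for exactly one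
tuple of exponents with `0 ≤ iₖ ≤ mₖ` for all `k`. -/
def IsOGSWith {G : Type*} [Group G] {n : ℕ} (a : Fin n → G) (m : Fin n → ℕ) : Prop :=
  ∀ g : G, ∃! i : Fin n → ℕ,
    (∀ k, i k ≤ m k) ∧ g = (List.ofFn fun k => a k ^ i k).prod

/-- `a₁, …, aₙ` is an ordered generating system of `G`: for some bounds `m₁, …, mₙ`, every element
of `G` has a unique representation `a₁ ^ i₁ * ⋯ * aₙ ^ iₙ` with `0 ≤ iₖ ≤ mₖ`. -/
def IsOGS {G : Type*} [Group G] {n : ℕ} (a : Fin n → G) : Prop :=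
  ∃ m : Fin n → ℕ, IsOGSWith a m

/-- `G` has an ordered generating system. -/
def HasOGS (G : Type*) [Group G] : Prop :=
  ∃ (n : ℕ) (a : Fin n → G), IsOGS a

namespace Mathieu

/-! The points `1, …, 24` are the elements of `Fin 24`, numerals being read modulo `24` (so the
point `24` is `0 : Fin 24`); similarly the points `1, …, 22` are the elements of `Fin 22`. The
permutation `[x₁, …, xᵣ].formPerm` is the cycle `(x₁, …, xᵣ)`. -/

def permD : Perm (Fin 24) :=
  [1, 2, 3, 4, 5, 6, 7, 8, 9, 10, 11, 12, 13, 14, 15, 16, 17, 18, 19, 20, 21, 22, 23].formPerm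

def permE : Perm (Fin 24) :=
  [3, 17, 10, 7, 9].formPerm * [4, 13, 14, 19, 5].formPerm *
    [8, 18, 11, 12, 23].formPerm * [15, 20, 22, 21, 16].formPerm

def permF : Perm (Fin 24) :=
  [1, 24].formPerm * [2, 23].formPerm * [3, 12].formPerm * [4, 16].formPerm *
    [5, 18].formPerm * [6, 10].formPerm * [7, 20].formPerm * [8, 14].formPerm *
    [9, 21].formPerm * [11, 17].formPerm * [13, 22].formPerm * [15, 19].formPerm

/-- The Mathieu group `M₂₄`, as a group of permutations of `24` points. -/
def M24 : Subgroup (Perm (Fin 24)) :=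
  Subgroup.closure {permD, permE, permF}

/-- The Mathieu group `M₂₃`: the stabilizer of the point `24` in `M₂₄`. -/
def M23 : Subgroup (Perm (Fin 24)) :=
  M24 ⊓ MulAction.stabilizer (Perm (Fin 24)) (24 : Fin 24)

def permX : Perm (Fin 22) :=
  [1, 2, 3, 4, 5, 6, 7, 8, 9, 10, 11].formPerm *
    [12, 13, 14, 15, 16, 17, 18, 19, 20, 21, 22].formPerm

def permY : Perm (Fin 22) :=
  [1, 4, 5, 9, 3].formPerm * [2, 8, 10, 7, 6].formPerm *
    [12, 15, 16, 20, 14].formPerm * [13, 19, 21, 18, 17].formPerm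

def permV : Perm (Fin 22) :=
  [11, 22].formPerm * [1, 21].formPerm * [2, 10, 8, 6].formPerm *
    [12, 14, 16, 20].formPerm * [3, 13, 4, 17].formPerm * [5, 19, 9, 18].formPerm

/-- The Mathieu group `M₂₂`, as a group of permutations of `22` points. -/
def M22 : Subgroup (Perm (Fin 22)) :=
  Subgroup.closure {permX, permY, permV}

end Mathieu

section OrderedProducts

variable {G : Type*} [Group G]

/-- The product `a₁ ^ i₁ * ⋯ * aₙ ^ iₙ`. -/
def orderedProd {n : ℕ} (a : Fin n → G) (i : Fin n → ℕ) : G :=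
  (List.ofFn fun k => a k ^ i k).prod

/-- The exponent tuples bounded by `m`. -/
def exponentBox {n : ℕ} (m : Fin n → ℕ) : Set (Fin n → ℕ) :=
  {i | ∀ k, i k ≤ m k}

theorem isOGSWith_iff_bijOn {n : ℕ} {a : Fin n → G} {m : Fin n → ℕ} :
    IsOGSWith a m ↔ Set.BijOn (orderedProd a) (exponentBox m) Set.univ := by
  constructor
  · intro h
    refine ⟨fun _ _ => Set.mem_univ _, fun i hi j hj hij => ?_, fun g _ => ?_⟩
    · exact (h (orderedProd a i)).unique ⟨hi, rfl⟩ ⟨hj, hij⟩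
    · obtain ⟨i, ⟨hi, hg⟩, -⟩ := h g
      exact ⟨i, hi, hg.symm⟩
  · intro h g
    obtain ⟨i, hi, hg⟩ := h.surjOn (Set.mem_univ g)
    exact ⟨i, ⟨hi, hg.symm⟩, fun j hj => h.injOn hj.1 hi (hj.2.symm.trans hg.symm)⟩

theorem orderedProd_cons {n : ℕ} (x : G) (a : Fin n → G) (i : Fin (n + 1) → ℕ) :
    orderedProd (Fin.cons x a : Fin (n + 1) → G) i =
      x ^ i 0 * orderedProd a (fun k => i k.succ) := by
  simp [orderedProd, List.ofFn_succ]

theorem map_orderedProd {H : Type*} [Group H] (f : G →* H) {n : ℕ} (a : Fin n → G)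
    (i : Fin n → ℕ) : f (orderedProd a i) = orderedProd (fun k => f (a k)) i := by
  simp [orderedProd, map_list_prod, List.map_ofFn, Function.comp_def]

/-- If `S` is the disjoint union of the sets `x ^ i * T` with `i ≤ M`, then an ordered factorization
of `T` extends to one of `S`. -/
theorem bijOn_orderedProd_cons {n : ℕ} {a : Fin n → G} {m : Fin n → ℕ} {S T : Set G} {x : G}
    {M : ℕ} (hS : Set.BijOn (fun p : ℕ × G => x ^ p.1 * p.2) (Set.Iic M ×ˢ T) S)
    (hT : Set.BijOn (orderedProd a) (exponentBox m) T) :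
    Set.BijOn (orderedProd (Fin.cons x a : Fin (n + 1) → G))
      (exponentBox (Fin.cons M m : Fin (n + 1) → ℕ)) S := by
  have hbox : ∀ i ∈ exponentBox (Fin.cons M m : Fin (n + 1) → ℕ),
      i 0 ≤ M ∧ (fun k : Fin n => i k.succ) ∈ exponentBox m := fun i hi =>
    ⟨by simpa using hi 0, fun k => by simpa using hi k.succ⟩
  refine ⟨fun i hi => ?_, fun i hi j hj hij => ?_, fun g hg => ?_⟩
  · rw [orderedProd_cons]
    exact hS.mapsTo (x := (i 0, orderedProd a fun k => i k.succ))
      ⟨(hbox i hi).1, hT.mapsTo (hbox i hi).2⟩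
  · rw [orderedProd_cons, orderedProd_cons] at hij
    have h := hS.injOn (x₁ := (i 0, orderedProd a fun k => i k.succ))
      (x₂ := (j 0, orderedProd a fun k => j k.succ))
      ⟨(hbox i hi).1, hT.mapsTo (hbox i hi).2⟩ ⟨(hbox j hj).1, hT.mapsTo (hbox j hj).2⟩ hij
    rw [Prod.mk.injEq] at h
    have h' := hT.injOn (hbox i hi).2 (hbox j hj).2 h.2
    funext k
    refine Fin.cases h.1 (fun k => congrFun h' k) k
  · obtain ⟨⟨e, t⟩, ⟨he, ht⟩, rfl⟩ := hS.surjOn hg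
    obtain ⟨i, hi, rfl⟩ := hT.surjOn ht
    refine ⟨Fin.cons e i, fun k => ?_, ?_⟩
    · refine Fin.cases ?_ (fun k => ?_) k
      · simpa using he
      · simpa using hi k
    · rw [orderedProd_cons]
      simp

theorem bijOn_orderedProd_nil (a : Fin 0 → G) (m : Fin 0 → ℕ) :
    Set.BijOn (orderedProd a) (exponentBox m) {1} := by
  refine ⟨fun i _ => by simp [orderedProd], fun i _ j _ _ => Subsingleton.elim _ _, ?_⟩
  rintro g rfl
  exact ⟨Fin.elim0, fun k => k.elim0, by simp [orderedProd]⟩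

theorem bijOn_orderedProd_coe {H : Subgroup G} {n : ℕ} {a : Fin n → H} {m : Fin n → ℕ} :
    IsOGSWith a m ↔
      Set.BijOn (orderedProd fun k => (a k : G)) (exponentBox m) (H : Set G) := by
  rw [isOGSWith_iff_bijOn]
  have hc : ∀ i, orderedProd (fun k => (a k : G)) i = orderedProd a i := fun i =>
    (map_orderedProd H.subtype a i).symm
  constructor
  · intro h
    refine ⟨fun i _ => ?_, fun i hi j hj hij => ?_, fun g hg => ?_⟩
    · rw [hc]
      exact SetLike.coe_mem _
    · rw [hc, hc] at hij
      exact h.injOn hi hj (Subtype.ext hij)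
    · obtain ⟨i, hi, h'⟩ := h.surjOn (Set.mem_univ (⟨g, hg⟩ : H))
      exact ⟨i, hi, by rw [hc, h']⟩
  · intro h
    refine ⟨fun _ _ => Set.mem_univ _, fun i hi j hj hij => ?_, fun g _ => ?_⟩
    · exact h.injOn hi hj (by rw [hc, hc, hij])
    · obtain ⟨i, hi, h'⟩ := h.surjOn g.2
      exact ⟨i, hi, Subtype.ext (by rw [← hc, h'])⟩

theorem HasOGS.of_mulEquiv {H : Type*} [Group H] (e : G ≃* H) (h : HasOGS G) : HasOGS H := by
  obtain ⟨n, a, m, ha⟩ := h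
  refine ⟨n, fun k => e (a k), m, isOGSWith_iff_bijOn.2 ?_⟩
  have hc : orderedProd (fun k => e (a k)) = e ∘ orderedProd a :=
    funext fun i => (map_orderedProd e.toMonoidHom a i).symm
  rw [hc]
  exact (Set.bijOn_univ.2 e.bijective).comp (isOGSWith_iff_bijOn.1 ha)

/-- The powers of an element of prime order `p` represent the cosets of a subgroup of index `p` and
order prime to `p`. -/
theorem existsUnique_pow_mul_mem_of_index_eq_prime {p : ℕ} [hp : Fact p.Prime] {H : Subgroup G}
    [Finite H] {x : G} (hH : H.index = p) (hcop : p.Coprime (Nat.card H)) (hx : orderOf x = p)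
    (g : G) : ∃! i : ℕ, i < p ∧ ∃ h ∈ H, g = x ^ i * h := by
  have hinj : ∀ i j : ℕ, i < p → j < p → (x ^ i)⁻¹ * x ^ j ∈ H → i = j := by
    intro i j hi hj hij
    have hbot : Subgroup.zpowers x ⊓ H = ⊥ :=
      (Subgroup.disjoint_of_coprime_natCard (by rwa [Nat.card_zpowers, hx])).eq_bot
    have h1 : (x ^ i)⁻¹ * x ^ j ∈ Subgroup.zpowers x ⊓ H :=
      ⟨(Subgroup.zpowers x).mul_mem ((Subgroup.zpowers x).inv_mem (Subgroup.npow_mem_zpowers x i))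
        (Subgroup.npow_mem_zpowers x j), hij⟩
    rw [hbot, Subgroup.mem_bot, inv_mul_eq_one] at h1
    exact pow_injOn_Iio_orderOf (by simpa [hx] using hi) (by simpa [hx] using hj) h1
  let f : Fin p → G ⧸ H := fun i => ((x ^ (i : ℕ) : G) : G ⧸ H)
  have hf : Function.Injective f := fun i j hij =>
    Fin.ext (hinj i j i.2 j.2 (QuotientGroup.eq.1 hij))
  have hcard : Nat.card (G ⧸ H) = p := hH
  have : Finite (G ⧸ H) := Nat.finite_of_card_ne_zero (hcard ▸ hp.out.ne_zero)
  obtain ⟨i, hi⟩ := (hf.bijective_of_nat_card_le (by rw [hcard, Nat.card_fin])).2 (g : G ⧸ H)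
  refine ⟨i, ⟨i.2, (x ^ (i : ℕ))⁻¹ * g, QuotientGroup.eq.1 hi, by simp⟩, ?_⟩
  rintro j ⟨hj, h, hh, rfl⟩
  refine (hinj i j i.2 hj ?_).symm
  have := H.mul_mem (QuotientGroup.eq.1 hi) (H.inv_mem hh)
  simpa [mul_assoc] using this

theorem bijOn_pow_mul_of_existsUnique {H : Subgroup G} {x : G} {M : ℕ}
    (h : ∀ g : G, ∃! i : ℕ, i < M + 1 ∧ ∃ y ∈ H, g = x ^ i * y) :
    Set.BijOn (fun p : ℕ × G => x ^ p.1 * p.2) (Set.Iic M ×ˢ (H : Set G)) Set.univ := by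
  refine ⟨fun _ _ => Set.mem_univ _, ?_, fun g _ => ?_⟩
  · rintro ⟨i, y⟩ ⟨hi, hy⟩ ⟨j, z⟩ ⟨hj, hz⟩ hij
    have hij' : x ^ i * y = x ^ j * z := hij
    obtain rfl : i = j := (h (x ^ i * y)).unique ⟨Nat.lt_succ_of_le hi, y, hy, rfl⟩
      ⟨Nat.lt_succ_of_le hj, z, hz, hij'⟩
    rw [mul_left_cancel hij']
  · obtain ⟨i, ⟨hi, y, hy, rfl⟩, -⟩ := h g
    exact ⟨(i, y), ⟨Nat.le_of_lt_succ hi, hy⟩, rfl⟩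

theorem IsOGSWith.cons {H : Subgroup G} {x : G} {M n : ℕ} {a : Fin n → H} {m : Fin n → ℕ}
    (ha : IsOGSWith a m) (h : ∀ g : G, ∃! i : ℕ, i < M + 1 ∧ ∃ y ∈ H, g = x ^ i * y) :
    IsOGSWith (Fin.cons x (fun k => (a k : G)) : Fin (n + 1) → G)
      (Fin.cons M m : Fin (n + 1) → ℕ) :=
  isOGSWith_iff_bijOn.2 <|
    bijOn_orderedProd_cons (bijOn_pow_mul_of_existsUnique h) (bijOn_orderedProd_coe.1 ha)

end OrderedProducts

section PermutationGroups

variable {α : Type*}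

/-- The elements of `K` which fix all points of `F` and map `p` into `Q`. -/
def fixingMapsInto (K : Subgroup (Perm α)) (F : List α) (p : α) (Q : List α) : Set (Perm α) :=
  {g | g ∈ K ∧ (∀ r ∈ F, g r = r) ∧ g p ∈ Q}

/-- If the lists `x ^ i • R`, `i ≤ M`, partition `Q`, then the sets `x ^ i * T`, where `T` consists
of the elements mapping `p` into `R`, partition the set of elements mapping `p` into `Q`. -/
theorem bijOn_pow_mul_fixingMapsInto {K : Subgroup (Perm α)} {F : List α} {p : α} {Q R : List α}
    {x : Perm α} {M : ℕ} (hxK : x ∈ K) (hxF : ∀ r ∈ F, x r = r)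
    (hcover : ∀ q ∈ Q, ∃ i ∈ List.range (M + 1), ∃ r ∈ R, x^[i] r = q)
    (hmaps : ∀ i ∈ List.range (M + 1), ∀ r ∈ R, x^[i] r ∈ Q)
    (hdisj : ∀ i ∈ List.range (M + 1), ∀ j ∈ List.range (M + 1), ∀ r ∈ R, ∀ s ∈ R,
      x^[i] r = x^[j] s → i = j) :
    Set.BijOn (fun e : ℕ × Perm α => x ^ e.1 * e.2) (Set.Iic M ×ˢ fixingMapsInto K F p R)
      (fixingMapsInto K F p Q) := by
  have hpow : ∀ i r, (x ^ i) r = x^[i] r := fun i r => by rw [Perm.iterate_eq_pow]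
  have hfix : ∀ i, ∀ r ∈ F, (x ^ i) r = r := fun i r hr => by
    rw [hpow, Function.iterate_fixed (hxF r hr)]
  have hrange : ∀ {i}, i ≤ M → i ∈ List.range (M + 1) := fun h =>
    List.mem_range.2 (Nat.lt_succ_of_le h)
  refine ⟨?_, ?_, ?_⟩
  · rintro ⟨i, g⟩ ⟨hi, hgK, hgF, hgR⟩
    refine ⟨mul_mem (pow_mem hxK i) hgK, fun r hr => ?_, ?_⟩
    · rw [Perm.mul_apply, hgF r hr, hfix i r hr]
    · rw [Perm.mul_apply, hpow]
      exact hmaps i (hrange hi) _ hgR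
  · rintro ⟨i, g⟩ ⟨hi, hgK, hgF, hgR⟩ ⟨j, h⟩ ⟨hj, hhK, hhF, hhR⟩ hij
    have hij' : x ^ i * g = x ^ j * h := hij
    have hp := congrArg (fun k : Perm α => k p) hij'
    simp only [Perm.mul_apply, hpow] at hp
    obtain rfl := hdisj i (hrange hi) j (hrange hj) _ hgR _ hhR hp
    rw [mul_left_cancel hij']
  · rintro g ⟨hgK, hgF, hgQ⟩
    obtain ⟨i, hi, r, hr, hir⟩ := hcover _ hgQ
    refine ⟨(i, (x ^ i)⁻¹ * g), ⟨Nat.le_of_lt_succ (List.mem_range.1 hi), ?_⟩, by simp⟩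
    refine ⟨mul_mem (inv_mem (pow_mem hxK i)) hgK, fun s hs => ?_, ?_⟩
    · rw [Perm.mul_apply, hgF s hs, Perm.inv_eq_iff_eq, hfix i s hs]
    · rw [Perm.mul_apply, ← hir, ← hpow, ← Perm.mul_apply, inv_mul_cancel]
      exact hr

theorem fixingMapsInto_singleton_self {K : Subgroup (Perm α)} {F : List α} {p q : α} {Q : List α}
    (h : ∀ g ∈ K, (∀ r ∈ p :: F, g r = r) → g q ∈ Q) :
    fixingMapsInto K F p [p] = fixingMapsInto K (p :: F) q Q := by
  ext g
  constructor
  · rintro ⟨hK, hF, hp⟩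
    have hF' : ∀ r ∈ p :: F, g r = r := List.forall_mem_cons.2 ⟨List.mem_singleton.1 hp, hF⟩
    exact ⟨hK, hF', h g hK hF'⟩
  · rintro ⟨hK, hF, -⟩
    exact ⟨hK, fun r hr => hF r (List.mem_cons_of_mem _ hr),
      List.mem_singleton.2 (hF p List.mem_cons_self)⟩

theorem apply_mem_of_fixing {g : Perm α} {F Q : List α} {q : α} (hg : ∀ r ∈ F, g r = r)
    (hq : q ∉ F) (h : ∀ s, s ∈ F ∨ s ∈ Q) : g q ∈ Q := by
  refine (h (g q)).resolve_left fun hs => hq ?_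
  have := g.injective (hg _ hs)
  rwa [this] at hs

end PermutationGroups

namespace Mathieu

/-- The 759 octads of the Steiner system `S(5, 8, 24)` preserved by `M24`, in binary notation. The
rows are increasing, and each is decreasing, so that the maximum of a row is its head. -/
def octadRows : List (List ℕ) :=
   [[138790, 132813, 126216, 115766, 104010, 102049, 96293, 90318, 86299, 84464, 78514, 76377,
    72588, 66407, 63108, 51025, 48147, 42232, 38189, 36294, 31554, 25513, 21116, 19095, 12757,
    10558, 6379],
    [305505, 301236, 295007, 290352, 280334, 277580, 271527, 267634, 265625, 252432, 237906,
    233607, 231532, 222723, 208020, 204097, 198058, 192585, 190626, 180636, 172597, 168928,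
    166667, 157028, 152753, 150618, 145176],
    [535268, 531249, 525274, 504864, 475812, 467213, 463064, 460851, 445445, 427666, 421910,
    416040, 410051, 408193, 402026, 396116, 385169, 381252, 371206, 361272, 351362, 345193,
    337856, 333333, 315939, 314056, 307594],
    [722544, 705094, 702724, 692282, 690385, 675712, 668866, 666665, 656663, 631877, 628112,
    615188, 611009, 608810, 602472, 600451, 596054, 590013, 580704, 574603, 567074, 560668,
    555160, 548979, 545190, 543053, 537103],
    [1070536, 1068323, 1062497, 1060490, 1050548, 1009728, 987906, 951624, 934425, 926128,
    921701, 919694, 890889, 884962, 861210, 855332, 843820, 837906, 832080, 820101, 816385,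
    804052, 792232, 790083, 770337, 762504, 742412],
    [1263753, 1256224, 1245726, 1230376, 1222017, 1217620, 1204944, 1200901, 1192108, 1189959,
    1186194, 1180025, 1164162, 1161408, 1155115, 1149205, 1134148, 1127686, 1121336, 1115347,
    1110320, 1103886, 1097957, 1090380, 1086105, 1084018, 1074205],
    [1613974, 1610051, 1608104, 1594898, 1584464, 1580165, 1573998, 1540673, 1525008, 1484824,
    1474854, 1446923, 1445088, 1410188, 1405448, 1384564, 1380769, 1378634, 1369154, 1351424,
    1337732, 1333329, 1327290, 1319699, 1315526, 1313325, 1265762],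
    [2126890, 2124993, 2120980, 2106966, 2103171, 2101096, 2019456, 1975812, 1916935, 1903248,
    1868849, 1852256, 1849378, 1843401, 1839388, 1805314, 1781777, 1769924, 1728778, 1722420,
    1710664, 1704611, 1687640, 1675812, 1664160, 1640201, 1632769],
    [2328324, 2322816, 2310229, 2298409, 2296514, 2268296, 2262115, 2255372, 2245426, 2242672,
    2236571, 2232654, 2230693, 2220640, 2207772, 2201890, 2195913, 2180760, 2172209, 2168036,
    2165775, 2154759, 2150610, 2148409, 2141072, 2136645, 2130606],
    [2675464, 2666657, 2664522, 2654580, 2639397, 2631052, 2626649, 2624690, 2605066, 2531524,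
    2527505, 2512448, 2501890, 2491452, 2460752, 2444033, 2437187, 2435240, 2425238, 2409888,
    2401801, 2384216, 2379917, 2377830, 2372388, 2365978, 2360049],
    [3179802, 3168928, 3162699, 3160329, 3154402, 3149879, 3147996, 3081345, 3050016, 2969648,
    2949708, 2921478, 2908802, 2893845, 2890176, 2883883, 2826278, 2820376, 2810896, 2775043,
    2769128, 2761537, 2757268, 2738308, 2720275, 2704706, 2702848],
    [3737697, 3704512, 3698756, 3686801, 3678776, 3672838, 3610628, 3563553, 3539848, 3474978,
    3457556, 3444840, 3442819, 3421328, 3409221, 3375280, 3351624, 3328320, 3322370, 3294342,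
    3280401, 3265537, 3237906, 3227948, 3220101, 3216208, 3189796],
    [4325622, 4309517, 4301220, 4296817, 4294810, 4282144, 4273289, 4271202, 4261212, 4253780,
    4249985, 4243818, 4241960, 4235971, 4231958, 4220306, 4215879, 4213932, 4206341, 4202192,
    4195899, 4063314, 4038912, 3951624, 3833869, 3806496, 3739786],
    [4596817, 4593028, 4556035, 4538962, 4536592, 4526126, 4524229, 4510744, 4490852, 4485344,
    4483083, 4473141, 4465308, 4461385, 4459426, 4441280, 4415544, 4409606, 4403780, 4391825,
    4367374, 4361520, 4346506, 4344417, 4337955, 4336072, 4331549],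
    [5003780, 4989254, 4984979, 4982904, 4921504, 4915275, 4888065, 4874373, 4870480, 4860434,
    4850476, 4845570, 4819776, 4803601, 4785798, 4768432, 4759833, 4755660, 4753447, 4744776,
    4731956, 4726026, 4720097, 4656648, 4645632, 4626498, 4620457],
    [5523073, 5514536, 5508118, 5476616, 5440549, 5423123, 5409412, 5405696, 5375810, 5350928,
    5333313, 5329044, 5315075, 5309160, 5280930, 5278793, 5268006, 5262104, 5255258, 5253297,
    5249380, 5243279, 5210132, 5129250, 5063048, 5055009, 5024896],
    [6344194, 6337856, 6325397, 6320657, 6308804, 6305926, 6299757, 6295992, 6293843, 6162689,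
    6100032, 6062602, 5939296, 5899416, 5842956, 5833010, 5817604, 5787689, 5785794, 5780352,
    5767765, 5709954, 5652556, 5640752, 5621792, 5550085, 5538256],
    [6949956, 6915112, 6889680, 6885637, 6842656, 6832158, 6820450, 6818441, 6750560, 6703248,
    6685191, 6656640, 6644740, 6594610, 6588684, 6560801, 6554826, 6531073, 6493202, 6475812,
    6455896, 6440201, 6432416, 6379592, 6373539, 6365962, 6359604],
    [8421811, 8412681, 8406754, 8404384, 8398155, 8393886, 8391797, 8126628, 8077824, 7903248,
    7873539, 7667737, 7622914, 7612992, 7479572, 7475393, 7473194, 7438406, 7409024, 7397512,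
    7373601, 7357552, 7345676, 7221256, 7127105, 7079696, 6979970],
    [8651244, 8619033, 8602440, 8599562, 8593633, 8589620, 8574210, 8564288, 8546577, 8542404,
    8536111, 8528774, 8524371, 8522424, 8507560, 8505411, 8499969, 8487636, 8483920, 8471941,
    8463916, 8458002, 8446490, 8440612, 8433766, 8431757, 8427864],
    [8981704, 8970688, 8966165, 8952450, 8946281, 8940550, 8930616, 8922769, 8918852, 8882560,
    8848454, 8831088, 8819212, 8807560, 8783649, 8741154, 8734748, 8723040, 8716939, 8693012,
    8688833, 8686634, 8675909, 8672144, 8663097, 8661202, 8657159],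
    [9489552, 9471495, 9465987, 9463912, 9453910, 9452052, 9442090, 9440193, 9347075, 9313296,
    9291264, 9252996, 9240913, 9195594, 9193633, 9186056, 9175606, 9126034, 9112069, 9077924,
    9073184, 9052252, 9048457, 9046370, 9021488, 9011470, 8983587],
    [10049792, 10035778, 10007560, 9978508, 9969957, 9965808, 9963547, 9849346, 9843008, 9830549,
    9801746, 9776129, 9748745, 9740960, 9720868, 9700952, 9691140, 9639552, 9607201, 9601226,
    9577522, 9571596, 9536864, 9519665, 9511320, 9506893, 9504934],
    [10781506, 10765331, 10751620, 10701856, 10666625, 10658088, 10651670, 10630149, 10618320,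
    10593410, 10572294, 10561860, 10557585, 10551418, 10536012, 10524208, 10510516, 10506593,
    10504586, 10498760, 10496547, 10486557, 10420264, 10258500, 10225026, 10126096, 10110017],
    [11731203, 11685912, 11666020, 11635208, 11575377, 11571588, 11560704, 11541570, 11535529,
    11419908, 11305112, 11281504, 11243584, 11142666, 11100169, 11076512, 11046145, 11029072,
    11022610, 11016236, 11010247, 10953232, 10883234, 10881097, 10846245, 10818824, 10811392],
    [12858882, 12812834, 12759184, 12747077, 12731924, 12719208, 12717187, 12688388, 12675712,
    12656663, 12652994, 12650793, 12641313, 12617608, 12611852, 12605490, 12599513, 12591984,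
    12587685, 12585550, 12325377, 12200064, 12125204, 12107810, 11878592, 11804686, 11798832],
    [13771273, 13714442, 13685312, 13674754, 13664316, 13640900, 13636881, 13501120, 13406496,
    13370381, 13313280, 13289480, 13189220, 13177368, 13141074, 13124355, 13121601, 13115562,
    13109652, 13062145, 12986404, 12976410, 12951624, 12911792, 12894342, 12880401, 12864832],
    [15747077, 15729298, 15534082, 15335473, 15245828, 15225984, 14959144, 14950785, 14946388,
    14876812, 14835778, 14818048, 14795024, 14747201, 14716939, 14715104, 14691352, 14681382,
    14442512, 14290950, 14254209, 14159392, 13959940, 13899912, 13893731, 13830224, 13779360],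
    [16253256, 16155648, 15806496]]

/-- The 759 octads of the Steiner system `S(5, 8, 24)` preserved by `M24`: the point `i` lies in the
octad `w` if the binary digit of `w` with weight `2 ^ i` is `1`. -/
def octads : List ℕ :=
  octadRows.flatten

/-- A search for `w` among the octads. -/
def findOctad (w : ℕ) : Bool :=
  octadRows.any fun r => Nat.ble w (r.headD 0) && r.elem w

theorem mem_octads_of_findOctad {w : ℕ} (h : findOctad w = true) : w ∈ octads := by
  obtain ⟨r, hr, hw⟩ := List.any_eq_true.1 h
  exact List.mem_flatten.2 ⟨r, hr, List.elem_iff.1 (Bool.and_eq_true _ _ ▸ hw).2⟩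

/-- The permutation `g` maps every octad onto an octad. -/
def PreservesOctads (g : Perm (Fin 24)) : Prop :=
  ∀ w ∈ octads, ∃ w' ∈ octads, ∀ i : Fin 24, w'.testBit (g i) = w.testBit i

theorem PreservesOctads.one : PreservesOctads 1 := fun w hw => ⟨w, hw, fun _ => rfl⟩

theorem PreservesOctads.mul {g h : Perm (Fin 24)} (hg : PreservesOctads g)
    (hh : PreservesOctads h) : PreservesOctads (g * h) := by
  intro w hw
  obtain ⟨w', hw', h1⟩ := hh w hw
  obtain ⟨w'', hw'', h2⟩ := hg w' hw'
  exact ⟨w'', hw'', fun i => by rw [Perm.mul_apply, h2, h1]⟩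

theorem PreservesOctads.pow {g : Perm (Fin 24)} (hg : PreservesOctads g) (n : ℕ) :
    PreservesOctads (g ^ n) := by
  induction n with
  | zero => exact pow_zero g ▸ PreservesOctads.one
  | succ n ih => exact pow_succ g n ▸ ih.mul hg

theorem PreservesOctads.inv {g : Perm (Fin 24)} (hg : PreservesOctads g) :
    PreservesOctads g⁻¹ := by
  have h : g⁻¹ = g ^ (orderOf g - 1) := by
    rw [inv_eq_iff_mul_eq_one, ← pow_succ', Nat.sub_add_cancel (orderOf_pos g), pow_orderOf_eq_one]
  exact h ▸ hg.pow _

/-- The image of a set of points, in binary notation, under the map with value table `t`. -/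
def imageMask (t : List ℕ) (w : ℕ) : ℕ :=
  (t.zipIdx.map fun e => if w.testBit e.2 then 2 ^ e.1 else 0).sum

theorem preservesOctads_of_table {g : Perm (Fin 24)} (t : List ℕ)
    (hg : ∀ i : Fin 24, t[(i : ℕ)]? = some (g i : ℕ))
    (h : (octads.all fun w => findOctad (imageMask t w) &&
      t.zipIdx.all fun e => (imageMask t w).testBit e.1 == w.testBit e.2) = true) :
    PreservesOctads g := by
  intro w hw
  have hw' := List.all_eq_true.1 h w hw
  rw [Bool.and_eq_true] at hw'
  refine ⟨imageMask t w, mem_octads_of_findOctad hw'.1, fun i => ?_⟩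
  simpa using List.all_eq_true.1 hw'.2 ((g i : ℕ), (i : ℕ))
    (List.mem_zipIdx_iff_getElem?.2 (hg i))

theorem preservesOctads_permD : PreservesOctads permD :=
  preservesOctads_of_table
    [0, 2, 3, 4, 5, 6, 7, 8, 9, 10, 11, 12, 13, 14, 15, 16, 17, 18, 19, 20, 21, 22, 23, 1]
    (by decide +kernel) (by decide +kernel)

theorem preservesOctads_permE : PreservesOctads permE :=
  preservesOctads_of_table
    [0, 1, 2, 17, 13, 4, 6, 9, 18, 3, 7, 12, 23, 14, 19, 20, 15, 10, 11, 5, 22, 16, 21, 8]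
    (by decide +kernel) (by decide +kernel)

theorem preservesOctads_permF : PreservesOctads permF :=
  preservesOctads_of_table
    [1, 0, 23, 12, 16, 18, 10, 20, 14, 21, 6, 17, 3, 22, 8, 19, 4, 11, 5, 15, 7, 9, 13, 2]
    (by decide +kernel) (by decide +kernel)

theorem preservesOctads_of_mem_M24 {g : Perm (Fin 24)} (hg : g ∈ M24) : PreservesOctads g := by
  refine Subgroup.closure_induction (p := fun g _ => PreservesOctads g) ?_ PreservesOctads.one
    (fun _ _ _ _ => PreservesOctads.mul) (fun _ _ => PreservesOctads.inv) hg
  rintro g (rfl | rfl | rfl)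
  exacts [preservesOctads_permD, preservesOctads_permE, preservesOctads_permF]

/-- The set of points `F` in binary notation. -/
def pointMask (F : List (Fin 24)) : ℕ :=
  F.foldr (fun (r : Fin 24) (m : ℕ) => 2 ^ (r : ℕ) ||| m) 0

theorem testBit_pointMask {F : List (Fin 24)} {j : ℕ} :
    (pointMask F).testBit j = true ↔ ∃ r ∈ F, (r : ℕ) = j := by
  induction F with
  | nil => simp [pointMask]
  | cons r F ih =>
    rw [pointMask, List.foldr_cons, Nat.testBit_or, Bool.or_eq_true, ← pointMask, ih]
    simp [Nat.testBit_two_pow]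

/-- The octad `w` is the only octad which contains its intersection with `m`. -/
def IsDeterminedBy (m w : ℕ) : Bool :=
  findOctad w && octads.all fun v => !Nat.beq (v &&& (w &&& m)) (w &&& m) || Nat.beq v w

theorem testBit_apply_of_isDeterminedBy {g : Perm (Fin 24)} (hg : PreservesOctads g)
    {F : List (Fin 24)} (hF : ∀ r ∈ F, g r = r) {w : ℕ}
    (hw : IsDeterminedBy (pointMask F) w = true) (i : Fin 24) :
    w.testBit (g i) = w.testBit i := by
  rw [IsDeterminedBy, Bool.and_eq_true, List.all_eq_true] at hw
  obtain ⟨v, hv, h⟩ := hg w (mem_octads_of_findOctad hw.1)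
  have hvw : v &&& (w &&& pointMask F) = w &&& pointMask F := by
    refine Nat.eq_of_testBit_eq fun j => ?_
    rw [Nat.testBit_and, Bool.and_eq_right_iff_imp, Nat.testBit_and, Bool.and_eq_true,
      testBit_pointMask]
    rintro ⟨hj, r, hr, rfl⟩
    have := h r
    rwa [hF r hr, hj] at this
  have hw' := hw.2 v hv
  rw [hvw, Nat.beq_refl, Bool.not_true, Bool.false_or] at hw'
  exact Nat.eq_of_beq_eq_true hw' ▸ h i

/-- A point which is separated from all others by octads determined by fixed points is fixed. -/
theorem apply_eq_self_of_isDeterminedBy {g : Perm (Fin 24)} (hg : PreservesOctads g)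
    {F : List (Fin 24)} (hF : ∀ r ∈ F, g r = r) {T : List ℕ}
    (hT : ∀ w ∈ T, IsDeterminedBy (pointMask F) w = true) {q : Fin 24}
    (hq : ∀ r : Fin 24, (∀ w ∈ T, w.testBit r = w.testBit q) → r = q) : g q = q :=
  hq _ fun w hw => testBit_apply_of_isDeterminedBy hg hF (hT w hw) q

theorem eq_one_of_fixes_base {g : Perm (Fin 24)} (hg : PreservesOctads g)
    (hF : ∀ r ∈ [2, 16, 3, 1, 18, 0, 23], g r = r) : g = 1 := by
  have h1 : ∀ r, r ≠ 7 → r ≠ 9 → g r = r := by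
    intro r h7 h9
    by_cases hr : r ∈ [2, 16, 3, 1, 18, 0, 23]
    · exact hF r hr
    refine apply_eq_self_of_isDeterminedBy hg hF (T := [12656663, 8734748, 2165775, 9506893,
      8716939, 4526126, 10846245, 295007, 467213, 8536111]) (by decide +kernel) ?_
    revert r
    decide +kernel
  have h2 : ∀ r ∈ (List.finRange 24).filter fun r => r ≠ 7 ∧ r ≠ 9, g r = r := fun r hr => by
    have := (List.mem_filter.1 hr).2
    exact h1 r (of_decide_eq_true this).1 (of_decide_eq_true this).2
  refine Perm.ext fun r => ?_
  refine apply_eq_self_of_isDeterminedBy hg h2 (T := [12611852, 6594610, 2883883, 2605066, 4195899,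
    804052, 10561860]) (by decide +kernel) ?_
  revert r
  decide +kernel

end Mathieu

namespace Mathieu

/-- The points of `Fin 22`, relabeled as points of `Fin 24` other than `23` and `24`. -/
def relabel : Fin 22 ↪ Fin 24 where
  toFun := ![1, 2, 3, 4, 13, 16, 19, 8, 5, 22, 21, 18, 14, 6, 20, 11, 17, 7, 15, 10, 9, 12]
  inj' := by decide +kernel

theorem exists_relabel_eq {i : Fin 24} (h0 : i ≠ 0) (h23 : i ≠ 23) : ∃ j, relabel j = i := by
  revert i
  decide +kernel

theorem relabel_ne (j : Fin 22) : relabel j ≠ 0 ∧ relabel j ≠ 23 := by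
  revert j
  decide +kernel

def liftX : Perm (Fin 24) where
  toFun := ![0, 14, 3, 4, 13, 22, 20, 15, 5, 12, 9, 17, 1, 16, 6, 10, 19, 7, 2, 8, 11, 18, 21, 23]
  invFun := ![0, 12, 18, 2, 3, 8, 14, 17, 19, 10, 15, 20, 9, 4, 1, 7, 13, 11, 21, 16, 6, 22, 5, 23]
  left_inv := by decide +kernel
  right_inv := by decide +kernel

def liftY : Perm (Fin 24) where
  toFun := ![0, 1, 13, 5, 2, 21, 10, 6, 19, 20, 12, 17, 15, 16, 11, 7, 22, 9, 18, 3, 14, 8, 4, 23]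
  invFun := ![0, 1, 4, 19, 22, 3, 7, 15, 21, 17, 6, 14, 10, 2, 20, 12, 13, 11, 18, 8, 9, 5, 16, 23]
  left_inv := by decide +kernel
  right_inv := by decide +kernel

def liftV : Perm (Fin 24) where
  toFun := ![0, 18, 12, 21, 6, 19, 13, 4, 8, 14, 22, 11, 2, 7, 20, 16, 10, 9, 1, 3, 17, 5, 15, 23]
  invFun := ![0, 18, 12, 19, 7, 21, 4, 13, 8, 17, 16, 11, 2, 6, 9, 22, 15, 20, 1, 5, 14, 3, 10, 23]
  left_inv := by decide +kernel
  right_inv := by decide +kernel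

theorem viaEmbedding_relabel_eq {e : Perm (Fin 22)} {g : Perm (Fin 24)} (h0 : g 0 = 0)
    (h23 : g 23 = 23) (h : ∀ j, g (relabel j) = relabel (e j)) :
    Perm.viaEmbeddingHom relabel e = g := by
  ext1 i
  rw [Perm.viaEmbeddingHom_apply]
  by_cases hi : ∃ j, relabel j = i
  · obtain ⟨j, rfl⟩ := hi
    rw [Perm.viaEmbedding_apply, h]
  · rw [Perm.viaEmbedding_apply_of_notMem _ _ _ hi]
    by_cases hi0 : i = 0
    · rw [hi0, h0]
    · by_cases hi23 : i = 23
      · rw [hi23, h23]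
      · exact (hi (exists_relabel_eq hi0 hi23)).elim

theorem viaEmbedding_permX : Perm.viaEmbeddingHom relabel permX = liftX :=
  viaEmbedding_relabel_eq (by decide +kernel) (by decide +kernel) (by decide +kernel)

theorem viaEmbedding_permY : Perm.viaEmbeddingHom relabel permY = liftY :=
  viaEmbedding_relabel_eq (by decide +kernel) (by decide +kernel) (by decide +kernel)

theorem viaEmbedding_permV : Perm.viaEmbeddingHom relabel permV = liftV :=
  viaEmbedding_relabel_eq (by decide +kernel) (by decide +kernel) (by decide +kernel)

theorem liftX_eq : liftX =
      permD * permE * permD * permE * permF * permE * permE * permE * permD * permE * permE *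
      permD * permD * permD * permE * permF * permD * permF :=
  Perm.ext (by decide +kernel)

theorem liftY_eq : liftY =
      permD * permF * permE * permE * permD * permF * permD * permE * permF * permD * permF *
      permE * permD * permF * permD * permE * permE * permF * permE :=
  Perm.ext (by decide +kernel)

theorem liftV_eq : liftV =
      permD * permE * permF * permD * permF * permE * permE * permE * permD * permF * permE *
      permD * permD * permD * permE * permE * permD * permD * permD :=
  Perm.ext (by decide +kernel)

/-- The image of `M22` in the symmetric group on `24` points. -/
noncomputable def liftedM22 : Subgroup (Perm (Fin 24)) :=
  M22.map (Perm.viaEmbeddingHom relabel)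

theorem liftedM22_eq_closure : liftedM22 = Subgroup.closure {liftX, liftY, liftV} := by
  rw [liftedM22, M22, MonoidHom.map_closure, Set.image_insert_eq, Set.image_pair,
    viaEmbedding_permX, viaEmbedding_permY, viaEmbedding_permV]

theorem liftedM22_le_M24 : liftedM22 ≤ M24 := by
  have hD : permD ∈ M24 := Subgroup.subset_closure (by simp)
  have hE : permE ∈ M24 := Subgroup.subset_closure (by simp)
  have hF : permF ∈ M24 := Subgroup.subset_closure (by simp)
  rw [liftedM22_eq_closure, Subgroup.closure_le]
  rintro g (rfl | rfl | rfl)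
  · rw [liftX_eq, SetLike.mem_coe]
    repeat' with_reducible first | exact hD | exact hE | exact hF | refine mul_mem ?_ ?_
  · rw [liftY_eq, SetLike.mem_coe]
    repeat' with_reducible first | exact hD | exact hE | exact hF | refine mul_mem ?_ ?_
  · rw [liftV_eq, SetLike.mem_coe]
    repeat' with_reducible first | exact hD | exact hE | exact hF | refine mul_mem ?_ ?_

theorem apply_mem_octad {g : Perm (Fin 24)} (hg : g ∈ M24)
    (hF : ∀ r ∈ [3, 1, 18, 0, 23], g r = r) : g 16 ∈ [7, 9, 16] := by
  have h := testBit_apply_of_isDeterminedBy (preservesOctads_of_mem_M24 hg) hF (w := 8716939)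
    (by decide +kernel) 16
  have h' : g 16 ∉ [3, 1, 18, 0, 23] := fun hm => by
    have := g.injective (hF _ hm)
    rw [this] at hm
    revert hm
    decide
  revert h h'
  generalize g 16 = q
  revert q
  decide +kernel

theorem apply_notMem_octad {g : Perm (Fin 24)} (hg : g ∈ M24)
    (hF : ∀ r ∈ [16, 3, 1, 18, 0, 23], g r = r) :
    g 2 ∈ [2, 4, 5, 6, 8, 10, 11, 12, 13, 14, 15, 17, 19, 20, 21, 22] := by
  have h := testBit_apply_of_isDeterminedBy (preservesOctads_of_mem_M24 hg) hF (w := 8716939)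
    (by decide +kernel) 2
  revert h
  generalize g 2 = q
  revert q
  decide +kernel

theorem fixingMapsInto_base : fixingMapsInto M24 [16, 3, 1, 18, 0, 23] 2 [2] = {1} := by
  ext g
  constructor
  · rintro ⟨hK, hF, h2⟩
    exact eq_one_of_fixes_base (preservesOctads_of_mem_M24 hK)
      (List.forall_mem_cons.2 ⟨List.mem_singleton.1 h2, hF⟩)
  · rintro rfl
    exact ⟨one_mem _, fun _ _ => rfl, List.mem_singleton.2 rfl⟩

/-- An ordered generating system of the stabilizer of the points `23` and `24` in `M24`. -/
def stabilizerOGS : Fin 11 → Perm (Fin 24) :=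
  ![liftX,
    liftV,
    liftX * liftV * liftX * liftX,
    liftV * liftY * liftX * liftV * liftX,
    liftY,
    liftX * liftY * liftV * liftX * liftV * liftY * liftV * liftX * liftY * liftV * liftY *
      liftX * liftX,
    liftX * liftV * liftV * liftX * liftV * liftX * liftV * liftY * liftX,
    liftV * liftV * liftY,
    liftY * liftX * liftY * liftV * liftX * liftV * liftX * liftY * liftV * liftX,
    liftX * liftY * liftV * liftX * liftV * liftV * liftY * liftV * liftX * liftY * liftV *
      liftX * liftV,
    liftX * liftV * liftY * liftX * liftY * liftV * liftV * liftV * liftX * liftV * liftV *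
      liftX * liftV]

theorem stabilizerOGS_mem (k : Fin 11) : stabilizerOGS k ∈ liftedM22 := by
  have hX : liftX ∈ liftedM22 := liftedM22_eq_closure ▸ Subgroup.subset_closure (by simp)
  have hY : liftY ∈ liftedM22 := liftedM22_eq_closure ▸ Subgroup.subset_closure (by simp)
  have hV : liftV ∈ liftedM22 := liftedM22_eq_closure ▸ Subgroup.subset_closure (by simp)
  fin_cases k <;> dsimp [stabilizerOGS] <;>
    repeat' with_reducible first | exact hX | exact hY | exact hV | refine mul_mem ?_ ?_

theorem bijOn_stabilizerOGS_fixingMapsInto :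
    Set.BijOn (orderedProd stabilizerOGS) (exponentBox ![10, 1, 6, 2, 4, 3, 2, 1, 1, 1, 1])
      (fixingMapsInto M24 [0, 23] 18
        [1, 2, 3, 4, 5, 6, 7, 8, 9, 10, 11, 12, 13, 14, 15, 16, 17, 18, 19, 20, 21, 22]) := by
  have hK : ∀ k, stabilizerOGS k ∈ M24 := fun k => liftedM22_le_M24 (stabilizerOGS_mem k)
  have h11 : Set.BijOn (orderedProd ![]) (exponentBox ![]) (fixingMapsInto M24 [16, 3, 1, 18,
      0, 23] 2 [2]) := by
    rw [fixingMapsInto_base]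
    exact bijOn_orderedProd_nil _ _
  have h10 := bijOn_orderedProd_cons (bijOn_pow_mul_fixingMapsInto (M := 1) (F := [16, 3, 1,
      18, 0, 23]) (p := 2) (Q := [2, 12]) (R := [2]) (hK 10) (by decide +kernel)
      (by decide +kernel) (by decide +kernel) (by decide +kernel)) h11
  have h9 := bijOn_orderedProd_cons (bijOn_pow_mul_fixingMapsInto (M := 1) (F := [16, 3, 1,
      18, 0, 23]) (p := 2) (Q := [2, 12, 15, 17]) (R := [2, 12]) (hK 9) (by decide +kernel)
      (by decide +kernel) (by decide +kernel) (by decide +kernel)) h10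
  have h8 := bijOn_orderedProd_cons (bijOn_pow_mul_fixingMapsInto (M := 1) (F := [16, 3, 1,
      18, 0, 23]) (p := 2) (Q := [2, 8, 11, 12, 13, 15, 17, 19]) (R := [2, 12, 15, 17]) (hK 8)
      (by decide +kernel) (by decide +kernel) (by decide +kernel) (by decide +kernel)) h9
  have h7 := bijOn_orderedProd_cons (bijOn_pow_mul_fixingMapsInto (M := 1) (F := [16, 3, 1,
      18, 0, 23]) (p := 2) (Q := [2, 4, 5, 6, 8, 10, 11, 12, 13, 14, 15, 17, 19, 20, 21, 22]) (R
      := [2, 8, 11, 12, 13, 15, 17, 19]) (hK 7) (by decide +kernel) (by decide +kernel)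
      (by decide +kernel) (by decide +kernel)) h8
  rw [← fixingMapsInto_singleton_self (p := 16) (F := [3, 1, 18, 0, 23]) fun g hg hF =>
      apply_notMem_octad hg hF] at h7
  have h6 := bijOn_orderedProd_cons (bijOn_pow_mul_fixingMapsInto (M := 2) (F := [3, 1, 18,
      0, 23]) (p := 16) (Q := [7, 9, 16]) (R := [16]) (hK 6) (by decide +kernel)
      (by decide +kernel) (by decide +kernel) (by decide +kernel)) h7
  rw [← fixingMapsInto_singleton_self (p := 3) (F := [1, 18, 0, 23]) fun g hg hF =>
      apply_mem_octad hg hF] at h6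
  have h5 := bijOn_orderedProd_cons (bijOn_pow_mul_fixingMapsInto (M := 3) (F := [1, 18, 0,
      23]) (p := 3) (Q := [3, 6, 16, 20]) (R := [3]) (hK 5) (by decide +kernel)
      (by decide +kernel) (by decide +kernel) (by decide +kernel)) h6
  have h4 := bijOn_orderedProd_cons (bijOn_pow_mul_fixingMapsInto (M := 4) (F := [1, 18, 0,
      23]) (p := 3) (Q := [2, 3, 4, 5, 6, 7, 8, 9, 10, 11, 12, 13, 14, 15, 16, 17, 19, 20, 21,
      22]) (R := [3, 6, 16, 20]) (hK 4) (by decide +kernel) (by decide +kernel)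
      (by decide +kernel) (by decide +kernel)) h5
  rw [← fixingMapsInto_singleton_self (p := 1) (F := [18, 0, 23]) fun g hg hF =>
      apply_mem_of_fixing hF (by decide) (by decide)] at h4
  have h3 := bijOn_orderedProd_cons (bijOn_pow_mul_fixingMapsInto (M := 2) (F := [18, 0, 23])
      (p := 1) (Q := [1, 9, 19]) (R := [1]) (hK 3) (by decide +kernel) (by decide +kernel)
      (by decide +kernel) (by decide +kernel)) h4
  have h2 := bijOn_orderedProd_cons (bijOn_pow_mul_fixingMapsInto (M := 6) (F := [18, 0, 23])
      (p := 1) (Q := [1, 2, 3, 4, 5, 6, 7, 8, 9, 10, 11, 12, 13, 14, 15, 16, 17, 19, 20, 21, 22])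
      (R := [1, 9, 19]) (hK 2) (by decide +kernel) (by decide +kernel) (by decide +kernel)
      (by decide +kernel)) h3
  rw [← fixingMapsInto_singleton_self (p := 18) (F := [0, 23]) fun g hg hF =>
      apply_mem_of_fixing hF (by decide) (by decide)] at h2
  have h1 := bijOn_orderedProd_cons (bijOn_pow_mul_fixingMapsInto (M := 1) (F := [0, 23]) (p
      := 18) (Q := [1, 18]) (R := [18]) (hK 1) (by decide +kernel) (by decide +kernel)
      (by decide +kernel) (by decide +kernel)) h2
  have h0 := bijOn_orderedProd_cons (bijOn_pow_mul_fixingMapsInto (M := 10) (F := [0, 23]) (p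
      := 18) (Q := [1, 2, 3, 4, 5, 6, 7, 8, 9, 10, 11, 12, 13, 14, 15, 16, 17, 18, 19, 20, 21,
      22]) (R := [1, 18]) (hK 0) (by decide +kernel) (by decide +kernel) (by decide +kernel)
      (by decide +kernel)) h1
  exact h0

/-- The stabilizer of the point `23` in `M23`. -/
def pointStabilizer : Subgroup M23 :=
  MulAction.stabilizer M23 (23 : Fin 24)

theorem mem_map_pointStabilizer {g : Perm (Fin 24)} :
    g ∈ pointStabilizer.map M23.subtype ↔ g ∈ M24 ∧ g 0 = 0 ∧ g 23 = 23 := by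
  constructor
  · rintro ⟨⟨g, hg⟩, h, rfl⟩
    exact ⟨hg.1, hg.2, h⟩
  · rintro ⟨h, h0, h23⟩
    exact ⟨⟨g, h, h0⟩, h23, rfl⟩

theorem bijOn_stabilizerOGS :
    Set.BijOn (orderedProd stabilizerOGS) (exponentBox ![10, 1, 6, 2, 4, 3, 2, 1, 1, 1, 1])
      (pointStabilizer.map M23.subtype : Subgroup (Perm (Fin 24))) := by
  convert bijOn_stabilizerOGS_fixingMapsInto using 1
  ext g
  rw [SetLike.mem_coe, mem_map_pointStabilizer]
  constructor
  · rintro ⟨h, h0, h23⟩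
    have hF : ∀ r ∈ [0, 23], g r = r := by simp [h0, h23]
    exact ⟨h, hF, apply_mem_of_fixing hF (by decide) (by decide)⟩
  · rintro ⟨h, hF, -⟩
    exact ⟨h, hF 0 (by simp), hF 23 (by simp)⟩

theorem map_pointStabilizer_eq : pointStabilizer.map M23.subtype = liftedM22 := by
  refine le_antisymm (fun g hg => ?_) fun g hg => ?_
  · obtain ⟨i, -, rfl⟩ := bijOn_stabilizerOGS.surjOn hg
    refine Subgroup.list_prod_mem _ fun x hx => ?_
    obtain ⟨k, rfl⟩ := (List.mem_ofFn' _ _).1 hx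
    exact pow_mem (stabilizerOGS_mem k) _
  · refine mem_map_pointStabilizer.2 ⟨liftedM22_le_M24 hg, ?_, ?_⟩ <;>
    · obtain ⟨e, -, rfl⟩ := hg
      rw [Perm.viaEmbeddingHom_apply]
      refine Perm.viaEmbedding_apply_of_notMem _ _ _ ?_
      rintro ⟨j, hj⟩
      first
      | exact (relabel_ne j).1 hj
      | exact (relabel_ne j).2 hj

theorem nonempty_pointStabilizer_mulEquiv : Nonempty (pointStabilizer ≃* M22) :=
  ⟨(pointStabilizer.equivMapOfInjective _ M23.subtype_injective).trans <|
    (MulEquiv.subgroupCongr map_pointStabilizer_eq).trans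
      (M22.equivMapOfInjective _ (Perm.viaEmbeddingHom_injective relabel)).symm⟩

theorem hasOGS_pointStabilizer : HasOGS pointStabilizer := by
  have hmem : ∀ k, stabilizerOGS k ∈ pointStabilizer.map M23.subtype := fun k =>
    map_pointStabilizer_eq ▸ stabilizerOGS_mem k
  refine HasOGS.of_mulEquiv (pointStabilizer.equivMapOfInjective _ M23.subtype_injective).symm
    ⟨11, fun k => ⟨stabilizerOGS k, hmem k⟩, _, bijOn_orderedProd_coe.2 bijOn_stabilizerOGS⟩

theorem permD_mem_M23 : permD ∈ M23 :=
  ⟨Subgroup.subset_closure (by simp),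
    MulAction.mem_stabilizer_iff.2 (show permD 0 = 0 by decide +kernel)⟩

theorem index_pointStabilizer : pointStabilizer.index = 23 := by
  have horb : MulAction.orbit M23 (23 : Fin 24) = {0}ᶜ := by
    ext q
    constructor
    · rintro ⟨g, rfl⟩ h
      have h0 : (g : Perm (Fin 24)) 0 = 0 := g.2.2
      exact absurd (g.1.injective ((show g.1 23 = 0 from h).trans h0.symm)) (by decide)
    · intro hq
      have hcyc : ∀ q : Fin 24, q ≠ 0 → ∃ i ∈ List.range 23, permD^[i] 23 = q := by
        decide +kernel
      obtain ⟨i, -, rfl⟩ := hcyc q hq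
      refine ⟨⟨permD, permD_mem_M23⟩ ^ i, ?_⟩
      rw [Perm.iterate_eq_pow]
      rfl
  rw [pointStabilizer, MulAction.index_stabilizer, horb, Set.ncard_compl, Set.ncard_singleton,
    Nat.card_fin]

theorem orderOf_permD : orderOf (⟨permD, permD_mem_M23⟩ : M23) = 23 := by
  have : Fact (Nat.Prime 23) := ⟨by norm_num⟩
  have h : permD^[23] = id := funext (by decide +kernel)
  refine orderOf_eq_prime (Subtype.ext (DFunLike.coe_injective ?_)) fun h1 => ?_
  · rw [SubmonoidClass.coe_pow, ← Perm.iterate_eq_pow, h]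
    rfl
  · have h2 : permD = 1 := (Subgroup.mk_eq_one M23).1 h1
    have h3 : permD 1 = 2 := by decide +kernel
    rw [h2] at h3
    exact absurd h3 (by decide)

theorem coprime_card_M22 : Nat.Coprime 23 (Nat.card M22) := by
  have hp : Nat.Prime 23 := by norm_num
  rw [hp.coprime_iff_not_dvd]
  intro h
  have h' := h.trans M22.card_subgroup_dvd_card
  rw [Nat.card_perm, Nat.card_fin, hp.dvd_factorial] at h'
  omega

end Mathieu

theorem theorem6 :
    -- `M₂₃` has an ordered generating system
    HasOGS Mathieu.M23 ∧
    -- `M₂₃` has a subgroup of index 23 that is isomorphic to `M₂₂` and has an OGS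
    (∃ H : Subgroup Mathieu.M23,
      H.index = 23 ∧ Nonempty (H ≃* Mathieu.M22) ∧ HasOGS H) ∧
    -- `M₂₃` has an element of order 23, and 23 is coprime to the order of `M₂₂`
    (∃ x : Mathieu.M23, orderOf x = 23) ∧
    Nat.Coprime 23 (Nat.card Mathieu.M22) ∧
    -- the construction of an OGS of `M₂₃` from any such subgroup and element
    (∀ (H : Subgroup Mathieu.M23) (x : Mathieu.M23),
      H.index = 23 → Nonempty (H ≃* Mathieu.M22) → orderOf x = 23 →
      -- every element of `M₂₃` lies in `x ^ i * H` for exactly one `0 ≤ i < 23`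
      (∀ g : Mathieu.M23, ∃! i : ℕ, i < 23 ∧ ∃ h ∈ H, g = x ^ i * h) ∧
      ∀ (n : ℕ) (a : Fin n → H) (m : Fin n → ℕ), IsOGSWith a m →
        IsOGSWith (Fin.cons x (fun k => (a k : Mathieu.M23)) : Fin (n + 1) → Mathieu.M23)
          (Fin.cons 22 m : Fin (n + 1) → ℕ)) := by
  have : Fact (Nat.Prime 23) := ⟨by norm_num⟩
  have key : ∀ (H : Subgroup Mathieu.M23) (x : Mathieu.M23),
      H.index = 23 → Nonempty (H ≃* Mathieu.M22) → orderOf x = 23 →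
      ∀ g : Mathieu.M23, ∃! i : ℕ, i < 23 ∧ ∃ h ∈ H, g = x ^ i * h := by
    rintro H x hH ⟨e⟩ hx g
    refine existsUnique_pow_mul_mem_of_index_eq_prime hH ?_ hx g
    rw [Nat.card_congr e.toEquiv]
    exact Mathieu.coprime_card_M22
  refine ⟨?_, ⟨_, Mathieu.index_pointStabilizer, Mathieu.nonempty_pointStabilizer_mulEquiv,
    Mathieu.hasOGS_pointStabilizer⟩, ⟨_, Mathieu.orderOf_permD⟩, Mathieu.coprime_card_M22,
    fun H x hH he hx => ⟨key H x hH he hx, fun n a m ha => ha.cons (key H x hH he hx)⟩⟩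
  obtain ⟨n, a, m, ha⟩ := Mathieu.hasOGS_pointStabilizer
  exact ⟨n + 1, _, _, ha.cons (key _ _ Mathieu.index_pointStabilizer
    Mathieu.nonempty_pointStabilizer_mulEquiv Mathieu.orderOf_permD)⟩
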